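/- Let $\Omega_1=\Omega_2=\{0,1\}^{\mathbb N}$ be two copies of the Cantor space, and for a finite binary string $a$ let $[a]$ be the set of its infinite extensions. Let $P$ be a computable probability measure on $\Omega_1\times\Omega_2$ (the reals $P([a]\times[b])$ are computable uniformly in $a,b$), and let $P_1$ be its marginal distribution on $\Omega_1$. Randomness is meant in the sense of Martin-Löf: a point is $\mu$-random if it does not belong to $\bigcap_n U_n$ for any uniformly effectively open sequence $(U_n)$ with $\mu(U_n)\le 2^{-n}$ for all $n$. Let $\alpha_1\in\Omega_1$ be $P_1$-random. Then the conditional measure $P(\cdot\,|\,\alpha_1)$ on $\Omega_2$ is well defined: $P_1([a])>0$ for every prefix $a$ of $\alpha_1$, and there is a unique measure $P(\cdot\,|\,\alpha_1)$ on $\Omega_2$ such that for every finite binary string $b$ $$P([b]\,|\,\alpha_1)=\lim_{n\to\infty}\frac{P([a_n]\times[b])}{P_1([a_n])},$$ where $a_n$ is the prefix of $\alpha_1$ of length $n$; it is a probability measure. Moreover, the set of all $\alpha_2\in\Omega_2$ such that the pair $(\alpha_1,\alpha_2)$ is $P$-random is measurable and has probability $1$ according to $P(\cdot\,|\,\alpha_1)$.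 -/

import Mathlib

open MeasureTheory Filter Topology
open scoped ENNReal

/-- The Cantor space of infinite binary sequences, with the product topology and
the product (= Borel) sigma-algebra. -/
abbrev Cantor : Type := ℕ → Bool

/-- The initial segment of length `n` of an infinite binary sequence. -/
def initSeg (α : Cantor) (n : ℕ) : List Bool := (List.range n).map α

/-- The interval `[a]`: all infinite binary sequences that extend the string `a`. -/
def cyl (a : List Bool) : Set Cantor := {α | initSeg α a.length = a}

/-- The basic open rectangle `[a] × [b]` in the product of two Cantor spaces. -/
def rect (p : List Bool × List Bool) : Set (Cantor × Cantor) := cyl p.1 ×ˢ cyl p.2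

/-- A measure on the product of two Cantor spaces is computable if the measures of the basic
rectangles `[a] × [b]` are computable real numbers, uniformly in `a` and `b`: an algorithm, given
`a`, `b` and `n`, finds the numerator of a dyadic rational with denominator `2 ^ n` that
approximates the measure of `[a] × [b]` with error at most `2 ^ (-n)`. -/
def IsComputableMeasure (P : Measure (Cantor × Cantor)) : Prop :=
  ∃ f : (List Bool × List Bool) × ℕ → ℕ, Computable f ∧
    ∀ (p : List Bool × List Bool) (n : ℕ),
      |P.real (rect p) - (f (p, n) : ℝ) / 2 ^ n| ≤ 1 / 2 ^ n

section Randomness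

variable {ι X : Type*} [Primcodable ι]

/-- `U 0, U 1, …` is a uniformly effectively open sequence of sets, with respect to the
indexed family `B` of basic open sets: each `U n` is the union of a family of basic sets, and
this family is recursively enumerable uniformly in `n`. -/
def UniformlyEffectivelyOpen (B : ι → Set X) (U : ℕ → Set X) : Prop :=
  ∃ W : ℕ × ι → Prop, REPred W ∧ ∀ n, U n = ⋃ i ∈ {i | W (n, i)}, B i

/-- A Martin-Löf test for the measure `μ`. -/
def IsMLTest [MeasurableSpace X] (B : ι → Set X) (μ : Measure X) (U : ℕ → Set X) : Prop :=
  UniformlyEffectivelyOpen B U ∧ ∀ n, μ (U n) ≤ (2 ^ n)⁻¹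

/-- `x` is Martin-Löf random with respect to `μ`: no Martin-Löf test rejects `x`. -/
def IsMLRandom [MeasurableSpace X] (B : ι → Set X) (μ : Measure X) (x : X) : Prop :=
  ∀ U : ℕ → Set X, IsMLTest B μ U → x ∉ ⋂ n, U n

end Randomness

/-- `Q` is the conditional measure `P(· | α₁)` on the second coordinate: all the intervals `[a]`
containing `α₁` have positive measure under the marginal distribution, and for every string `b`
the conditional probability `P([a] × [b]) / P([a] × Ω₂)` tends to `Q [b]` as the length of the
prefix `a` of `α₁` tends to infinity. -/
def IsConditionalMeasure (P : Measure (Cantor × Cantor)) (α₁ : Cantor) (Q : Measure Cantor) :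
    Prop :=
  (∀ n, P.fst (cyl (initSeg α₁ n)) ≠ 0) ∧
    ∀ b : List Bool,
      Tendsto (fun n => P (rect (initSeg α₁ n, b)) / P.fst (cyl (initSeg α₁ n))) atTop
        (𝓝 (Q (cyl b)))

/-!
Let `P₁` be the first marginal of `P` and fix a string `b`. By the definition of conditional
probability, the ratio `P ([a] × [b]) / P₁ [a]` is a martingale along the prefixes `a` of a
sequence. For rationals `q < r`, the sequences along which this ratio crosses `(q, r)` upwards `k`
times form an effectively open set of `P₁`-measure at most `(q / r) ^ k`: between two of its low
points `u`, where `P ([u] × [b]) < q P₁ [u]`, the ratio has a high point, and a set covered by high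
points which lies inside a set covered by low points has at most `q / r` of the `P₁`-measure of the
latter. Hence a random `α₁` has only finitely many upcrossings of each interval, and the ratios
converge along it. The limits are the values of a measure on the intervals `[b]`, since the space of
probability measures on the Cantor space is compact.

For a Martin-Löf test `U` of `P`, the prefixes `a` above which `U (2 * n)` has conditional measure
greater than `2 ^ (-n)` can be enumerated, and as `P (U (2 * n)) ≤ 2 ^ (-2 * n)` they cover a set of
`P₁`-measure at most `2 ^ (-n)`. So for infinitely many `n` no prefix of the random `α₁` is of this
kind; passing to the limit along the prefixes of `α₁`, the section of `U (2 * n)` at `α₁` has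
conditional measure at most `2 ^ (-n)`. The pairs `(α₁, α₂)` rejected by one of the countably many
tests therefore form a set with a null section at `α₁`.
-/

open scoped NNReal NNRat ProbabilityTheory

section RecursivelyEnumerable

variable {α β γ : Type*} [Primcodable α] [Primcodable β] [Primcodable γ]

theorem exists_code_eval_dom_iff {p : α → Prop} (hp : REPred p) :
    ∃ c : Nat.Partrec.Code, ∀ a, (c.eval (Encodable.encode a)).Dom ↔ p a := by
  obtain ⟨c, hc⟩ := Nat.Partrec.Code.exists_code.1 hp
  exact ⟨c, fun a => by simp [hc, Part.assert, Part.bind, Part.map]⟩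

theorem countable_setOf_rePred : {p : α → Prop | REPred p}.Countable := by
  refine (Set.countable_range fun (c : Nat.Partrec.Code) (a : α) =>
    (c.eval (Encodable.encode a)).Dom).mono fun p hp => ?_
  obtain ⟨c, hc⟩ := exists_code_eval_dom_iff hp
  exact ⟨c, funext fun a => propext (hc a)⟩

theorem rePred_of_primrecPred {p : α → Prop} (hp : PrimrecPred p) : REPred p := by
  classical
  exact ComputablePred.to_re ⟨inferInstance, hp.decide.to_comp⟩

theorem rePred_comp {p : β → Prop} {f : α → β} (hp : REPred p) (hf : Computable f) :
    REPred fun a => p (f a) :=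
  Partrec.comp hp hf

theorem rePred_exists_nat {R : α → ℕ → Prop} (hR : PrimrecRel R) : REPred fun a => ∃ n, R a n := by
  classical
  refine (Partrec.rfind (p := fun a n => Part.some (decide (R a n)))
    hR.decide.to_comp.partrec).dom_re.of_eq fun a => Nat.rfind_dom.trans ⟨?_, ?_⟩
  · rintro ⟨n, hn, -⟩
    exact ⟨n, by simpa using hn⟩
  · rintro ⟨n, hn⟩
    exact ⟨n, by simpa using hn, fun _ => trivial⟩

theorem exists_primrecRel_monotone_of_rePred {p : α → Prop} (hp : REPred p) :
    ∃ R : α → ℕ → Prop, PrimrecRel R ∧ (∀ a, Monotone (R a)) ∧ ∀ a, p a ↔ ∃ n, R a n := by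
  obtain ⟨c, hc⟩ := exists_code_eval_dom_iff hp
  refine ⟨fun a n => (c.evaln n (Encodable.encode a)).isSome = true, ?_, ?_, ?_⟩
  · exact Primrec.eq.comp (Primrec.option_isSome.comp (Nat.Partrec.Code.primrec_evaln.comp
      ((Primrec.snd.pair (Primrec.const c)).pair (Primrec.encode.comp Primrec.fst))))
      (Primrec.const true)
  · intro a m n hmn h
    obtain ⟨x, hx⟩ := Option.isSome_iff_exists.1 h
    exact Option.isSome_iff_exists.2 ⟨x, Nat.Partrec.Code.evaln_mono hmn hx⟩
  · intro a
    simp only [← hc, Part.dom_iff_mem, Nat.Partrec.Code.evaln_complete,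
      Option.isSome_iff_exists, Option.mem_def]
    exact exists_comm

theorem rePred_and {p q : α → Prop} (hp : REPred p) (hq : REPred q) :
    REPred fun a => p a ∧ q a := by
  obtain ⟨R, hR, hR_mono, hpR⟩ := exists_primrecRel_monotone_of_rePred hp
  obtain ⟨S, hS, hS_mono, hqS⟩ := exists_primrecRel_monotone_of_rePred hq
  have hRS : PrimrecRel fun a n => R a n ∧ S a n := PrimrecPred.and hR hS
  refine (rePred_exists_nat hRS).of_eq fun a => ?_
  rw [hpR, hqS]
  refine ⟨fun ⟨n, hm, hn⟩ => ⟨⟨n, hm⟩, n, hn⟩, fun ⟨⟨m, hm⟩, n, hn⟩ => ?_⟩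
  exact ⟨max m n, hR_mono a (le_max_left m n) hm, hS_mono a (le_max_right m n) hn⟩

theorem rePred_exists {p : α × β → Prop} (hp : REPred p) : REPred fun a => ∃ b, p (a, b) := by
  classical
  obtain ⟨R, hR, -, hpR⟩ := exists_primrecRel_monotone_of_rePred hp
  have hsearch : PrimrecRel fun (a : α) (k : ℕ) =>
      ∃ b ∈ (Encodable.decode (α := β) k.unpair.1).toList, R (a, b) k.unpair.2 := by
    have hR' : PrimrecRel fun (b : β) (x : α × ℕ) => R (x.1, b) x.2 :=
      hR.comp ((Primrec.fst.comp Primrec.snd).pair Primrec.fst) (Primrec.snd.comp Primrec.snd)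
    have hk : Primrec fun x : α × ℕ => x.2.unpair := Primrec.unpair.comp Primrec.snd
    exact hR'.exists_mem_list.comp
      (Primrec.optionToList.comp (Primrec.decode.comp (Primrec.fst.comp hk)))
      (Primrec.fst.pair (Primrec.snd.comp hk))
  refine (rePred_exists_nat hsearch).of_eq fun a => ⟨?_, ?_⟩
  · rintro ⟨k, b, -, hb⟩
    exact ⟨b, (hpR _).2 ⟨_, hb⟩⟩
  · rintro ⟨b, hb⟩
    obtain ⟨n, hn⟩ := (hpR _).1 hb
    exact ⟨Nat.pair (Encodable.encode b) n, b, by simp, by simpa using hn⟩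

theorem rePred_forall_mem_list {p : β × γ → Prop} (hp : REPred p) :
    REPred fun x : List β × γ => ∀ b ∈ x.1, p (b, x.2) := by
  obtain ⟨R, hR, hR_mono, hpR⟩ := exists_primrecRel_monotone_of_rePred hp
  have hR_list : PrimrecRel fun (x : List β × γ) (n : ℕ) => ∀ b ∈ x.1, R (b, x.2) n := by
    have hR' : PrimrecRel fun (b : β) (y : γ × ℕ) => R (b, y.1) y.2 :=
      hR.comp (Primrec.fst.pair (Primrec.fst.comp Primrec.snd)) (Primrec.snd.comp Primrec.snd)
    exact hR'.forall_mem_list.comp (Primrec.fst.comp Primrec.fst)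
      ((Primrec.snd.comp Primrec.fst).pair Primrec.snd)
  refine (rePred_exists_nat hR_list).of_eq fun ⟨l, c⟩ => ?_
  simp only [hpR]
  refine ⟨fun ⟨n, hn⟩ b hb => ⟨n, hn b hb⟩, fun h => ?_⟩
  choose! stage hstage using h
  obtain ⟨N, hN⟩ := (l.finite_toSet.image stage).bddAbove
  exact ⟨N, fun b hb => hR_mono _ (hN (Set.mem_image_of_mem stage hb)) (hstage b hb)⟩

theorem primrec_zip_tail : Primrec fun l : List β => l.zip l.tail := by
  have hstep : Primrec₂ fun (_ : List β) (x : β × List β × List (β × β)) =>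
      (x.2.1.head?.map (Prod.mk x.1)).toList ++ x.2.2 := by
    have htail : Primrec fun y : List β × β × List β × List (β × β) => y.2.2 :=
      Primrec.snd.comp Primrec.snd
    exact Primrec.list_append.comp (Primrec.optionToList.comp (Primrec.option_map
      (Primrec.list_head?.comp (Primrec.fst.comp htail))
      ((Primrec.fst.comp (Primrec.snd.comp Primrec.fst)).pair Primrec.snd)))
      (Primrec.snd.comp htail)
  refine (Primrec.list_rec Primrec.id (Primrec.const []) hstep).of_eq fun l => ?_
  induction l with
  | nil => rfl
  | cons b t ih => cases t <;> simp_all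

theorem isChain_iff_forall_mem_zip_tail {δ : Type*} {R : δ → δ → Prop} {l : List δ} :
    l.IsChain R ↔ ∀ e ∈ l.zip l.tail, R e.1 e.2 := by
  induction l with
  | nil => simp
  | cons b t ih => cases t <;> simp_all

theorem rePred_isChain {R : β → β → Prop} (hR : REPred fun e : β × β => R e.1 e.2) :
    REPred fun l : List β => l.IsChain R := by
  have hR' : REPred fun x : (β × β) × Unit => R x.1.1 x.1.2 := rePred_comp hR Computable.fst
  refine (rePred_comp (rePred_forall_mem_list hR')
    (primrec_zip_tail.to_comp.pair (Computable.const ()))).of_eq fun l => ?_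
  exact isChain_iff_forall_mem_zip_tail.symm

theorem primrecPred_nodup : PrimrecPred fun l : List β => l.Nodup := by
  classical
  have hcount : PrimrecRel fun (b : β) (l : List β) => (l.filter (· = b)).length ≤ 1 :=
    Primrec.nat_le.comp (Primrec.list_length.comp
      (Primrec.eq.listFilter.comp Primrec.snd Primrec.fst)) (Primrec.const 1)
  refine (hcount.forall_mem_list.comp Primrec.id Primrec.id).of_eq fun l => ?_
  rw [List.nodup_iff_count_le_one]
  have hcount_eq (b : β) : (l.filter (· = b)).length = l.count b := by
    rw [List.count, List.countP_eq_length_filter]; congr 1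
  simp only [id, hcount_eq]
  refine ⟨fun h b => ?_, fun h b _ => h b⟩
  by_cases hb : b ∈ l
  · exact h b hb
  · simp [List.count_eq_zero.2 hb]

theorem primrecPred_isAntichain {R : β → β → Prop} (hR : PrimrecRel R) :
    PrimrecPred fun l : List β => IsAntichain R {b | b ∈ l} := by
  have hpair : PrimrecRel fun b c : β => b = c ∨ ¬ R b c := PrimrecPred.or Primrec.eq hR.not
  have hrow : PrimrecRel fun (b : β) (l : List β) => ∀ c ∈ l, b = c ∨ ¬ R b c :=
    hpair.swap.forall_mem_list.swap
  refine (hrow.forall_mem_list.comp Primrec.id Primrec.id).of_eq fun l => ?_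
  simp only [IsAntichain, Set.Pairwise, or_iff_not_imp_left]
  rfl

theorem primrecRel_isPrefix : PrimrecRel fun l₁ l₂ : List β => l₁ <+: l₂ := by
  classical
  exact (Primrec.eq.comp Primrec.fst
    (Primrec.list_take.comp (Primrec.list_length.comp Primrec.fst) Primrec.snd)).of_eq
      fun _ => List.prefix_iff_eq_take.symm

theorem computable_list_sum_map {f : β × γ → ℕ} (hf : Computable f) :
    Computable fun x : List β × γ => (x.1.map fun b => f (b, x.2)).sum := by
  have hstep : Computable₂ fun (x : List β × γ) (y : ℕ × ℕ) =>
      y.2 + (x.1[y.1]?.map fun b => f (b, x.2)).getD 0 := by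
    refine Primrec.nat_add.to_comp.comp (Computable.snd.comp Computable.snd)
      (Computable.option_getD (Computable.option_map ?_ ?_) (Computable.const 0))
    · exact Computable.list_getElem?.comp (Computable.fst.comp Computable.fst)
        (Computable.fst.comp Computable.snd)
    · exact hf.comp (Computable.snd.pair (Computable.snd.comp (Computable.fst.comp Computable.fst)))
  refine (Computable.nat_rec (Computable.list_length.comp Computable.fst) (Computable.const 0)
    hstep).of_eq fun ⟨l, c⟩ => ?_
  suffices ∀ n, Nat.rec (motive := fun _ => ℕ) 0
      (fun i s => s + (l[i]?.map fun b => f (b, c)).getD 0) n =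
        ((l.take n).map fun b => f (b, c)).sum by simpa using this l.length
  intro n
  induction n with
  | zero => simp
  | succ n ih =>
    rw [List.take_add_one, List.map_append, List.sum_append, ← ih]
    cases hn : l[n]? <;> simp [hn]

end RecursivelyEnumerable

section UniformlyComputable

variable {α β γ : Type*} [Primcodable α] [Primcodable β] [Primcodable γ]

/-- The values of `f` are computable nonnegative reals, uniformly in the argument: `f a` is
approximated by dyadic rationals `g (a, n) / 2 ^ n`. The error is a computable multiple
`c a / 2 ^ n` of `2 ^ (-n)` instead of `2 ^ (-n)` itself, so that sums and multiples of
approximations need no change of precision. -/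
def IsUniformlyComputable (f : α → ℝ≥0∞) : Prop :=
  (∀ a, f a ≠ ∞) ∧ ∃ (g : α × ℕ → ℕ) (c : α → ℕ), Computable g ∧ Computable c ∧
    ∀ a n, |2 ^ n * (f a).toReal - g (a, n)| ≤ c a

namespace IsUniformlyComputable

theorem comp {f : β → ℝ≥0∞} (hf : IsUniformlyComputable f) {h : α → β} (hh : Computable h) :
    IsUniformlyComputable fun a => f (h a) := by
  obtain ⟨hf_top, g, c, hg, hc, hfg⟩ := hf
  exact ⟨fun a => hf_top _, fun x => g (h x.1, x.2), fun a => c (h a),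
    hg.comp ((hh.comp Computable.fst).pair Computable.snd), hc.comp hh, fun a n => hfg _ _⟩

theorem natCast_mul {f : α → ℝ≥0∞} (hf : IsUniformlyComputable f) {k : α → ℕ}
    (hk : Computable k) : IsUniformlyComputable fun a => k a * f a := by
  obtain ⟨hf_top, g, c, hg, hc, hfg⟩ := hf
  have hmul := Primrec.nat_mul.to_comp
  refine ⟨fun a => ENNReal.mul_ne_top (ENNReal.natCast_ne_top _) (hf_top a),
    fun x => k x.1 * g x, fun a => k a * c a,
    hmul.comp (hk.comp Computable.fst) hg, hmul.comp hk hc, fun a n => ?_⟩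
  have h : (2 : ℝ) ^ n * (k a * f a).toReal - (k a * g (a, n) : ℕ) =
      k a * (2 ^ n * (f a).toReal - g (a, n)) := by
    simp only [ENNReal.toReal_mul, ENNReal.toReal_natCast, Nat.cast_mul]; ring
  rw [h, abs_mul, Nat.abs_cast, Nat.cast_mul]
  gcongr
  exact hfg a n

theorem nnratCast_mul {f : α → ℝ≥0∞} (hf : IsUniformlyComputable f) (q : ℚ≥0) :
    IsUniformlyComputable fun a => (q : ℝ≥0) * f a := by
  obtain ⟨-, g, c, hg, hc, hfg⟩ := hf.natCast_mul (Computable.const q.num)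
  refine ⟨fun a => ENNReal.mul_ne_top ENNReal.coe_ne_top (hf.1 a), fun x => g x / q.den,
    fun a => c a + 1, Primrec.nat_div.to_comp.comp hg (Computable.const q.den),
    Computable.succ.comp hc, fun a n => ?_⟩
  have hden : (1 : ℝ) ≤ q.den := by exact_mod_cast q.den_pos
  have hscale : q.den * (2 ^ n * (((q : ℝ≥0) : ℝ≥0∞) * f a).toReal) =
      2 ^ n * ((q.num : ℝ≥0∞) * f a).toReal := by
    have hq : ((q : ℝ≥0) : ℝ) * q.den = q.num := by
      change (q : ℝ) * q.den = q.num
      exact_mod_cast q.mul_den_eq_num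
    simp only [ENNReal.toReal_mul, ENNReal.coe_toReal,
      ENNReal.toReal_natCast, ← hq]
    ring
  have happrox := abs_le.1 (hfg a n)
  rw [← hscale] at happrox
  have hfloor_le : (q.den : ℝ) * (g (a, n) / q.den : ℕ) ≤ g (a, n) := by
    exact_mod_cast Nat.mul_div_le _ _
  have hlt_floor : (g (a, n) : ℝ) < q.den * ((g (a, n) / q.den : ℕ) + 1) := by
    exact_mod_cast Nat.lt_mul_div_succ _ q.den_pos
  have hc_den : (c a : ℝ) ≤ q.den * c a := le_mul_of_one_le_left (Nat.cast_nonneg _) hden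
  rw [Nat.cast_succ, abs_le]
  constructor <;> refine le_of_mul_le_mul_left ?_ (zero_lt_one.trans_le hden) <;> linarith

theorem list_sum_map {f : β × γ → ℝ≥0∞} (hf : IsUniformlyComputable f) :
    IsUniformlyComputable fun x : List β × γ => (x.1.map fun b => f (b, x.2)).sum := by
  obtain ⟨hf_top, g, c, hg, hc, hfg⟩ := hf
  have hsum_top (l : List β) (y : γ) : (l.map fun b => f (b, y)).sum ≠ ∞ := by
    induction l with
    | nil => simp
    | cons b l ih => simpa using ⟨hf_top _, ih⟩
  have hg_sum : Computable fun x : List β × γ × ℕ =>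
      (x.1.map fun b => g ((b, x.2.1), x.2.2)).sum :=
    computable_list_sum_map (f := fun y : β × γ × ℕ => g ((y.1, y.2.1), y.2.2))
      (hg.comp ((Computable.fst.pair (Computable.fst.comp Computable.snd)).pair
        (Computable.snd.comp Computable.snd)))
  have hassoc : Computable fun x : (List β × γ) × ℕ => (x.1.1, x.1.2, x.2) :=
    (Computable.fst.comp Computable.fst).pair
      ((Computable.snd.comp Computable.fst).pair Computable.snd)
  refine ⟨fun x => hsum_top x.1 x.2, _, fun x => (x.1.map fun b => c (b, x.2)).sum,
    hg_sum.comp hassoc, computable_list_sum_map hc, ?_⟩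
  · rintro ⟨l, y⟩ n
    dsimp only
    induction l with
    | nil => simp
    | cons b l ih =>
      have hb := hfg (b, y) n
      simp only [List.map_cons, List.sum_cons, ENNReal.toReal_add (hf_top _) (hsum_top l y),
        Nat.cast_add]
      rw [abs_le] at *
      constructor <;> linarith

theorem rePred_lt {f₁ f₂ : α → ℝ≥0∞} (hf₁ : IsUniformlyComputable f₁)
    (hf₂ : IsUniformlyComputable f₂) : REPred fun a => f₁ a < f₂ a := by
  obtain ⟨hf₁_top, g₁, c₁, hg₁, hc₁, hfg₁⟩ := hf₁
  obtain ⟨hf₂_top, g₂, c₂, hg₂, hc₂, hfg₂⟩ := hf₂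
  have hsep : REPred fun x : α × ℕ => g₁ x + (c₁ x.1 + c₂ x.1) < g₂ x := by
    have hadd := Primrec.nat_add.to_comp
    exact ComputablePred.to_re ⟨inferInstance, Primrec.nat_lt.decide.to_comp.comp
      (hadd.comp hg₁ (hadd.comp (hc₁.comp Computable.fst) (hc₂.comp Computable.fst))) hg₂⟩
  refine (rePred_exists hsep).of_eq fun a => ?_
  rw [← ENNReal.toReal_lt_toReal (hf₁_top a) (hf₂_top a)]
  constructor
  · rintro ⟨n, hn⟩
    have hn' : (g₁ (a, n) + (c₁ a + c₂ a) : ℝ) < g₂ (a, n) := by exact_mod_cast hn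
    have h₁ := (abs_le.1 (hfg₁ a n)).2
    have h₂ := (abs_le.1 (hfg₂ a n)).1
    exact lt_of_mul_lt_mul_left (by linarith) (by positivity : (0 : ℝ) ≤ 2 ^ n)
  · intro hlt
    obtain ⟨n, hn⟩ := pow_unbounded_of_one_lt
      (2 * (c₁ a + c₂ a) / ((f₂ a).toReal - (f₁ a).toReal)) (one_lt_two (α := ℝ))
    rw [div_lt_iff₀ (sub_pos.2 hlt)] at hn
    have h₁ := (abs_le.1 (hfg₁ a n)).1
    have h₂ := (abs_le.1 (hfg₂ a n)).2
    have hn' : (g₁ (a, n) + (c₁ a + c₂ a) : ℝ) < g₂ (a, n) := by linarith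
    exact ⟨n, by exact_mod_cast hn'⟩

end IsUniformlyComputable

end UniformlyComputable

section CantorSpace

theorem length_initSeg (α : Cantor) (n : ℕ) : (initSeg α n).length = n := by
  simp [initSeg]

theorem mem_cyl_initSeg (α : Cantor) (n : ℕ) : α ∈ cyl (initSeg α n) := by
  rw [cyl, Set.mem_ofPred_eq, length_initSeg]

theorem cyl_nil : cyl [] = Set.univ := by
  ext α; simp [cyl, initSeg]

theorem initSeg_prefix_initSeg (α : Cantor) {m n : ℕ} (h : m ≤ n) :
    initSeg α m <+: initSeg α n := by
  rw [List.prefix_iff_eq_take, length_initSeg]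
  simp [initSeg, ← List.map_take, List.take_range, h]

theorem prefix_initSeg_iff {α : Cantor} {a : List Bool} {n : ℕ} :
    a <+: initSeg α n ↔ a.length ≤ n ∧ α ∈ cyl a := by
  refine ⟨fun h => ?_, fun ⟨hn, (hα : initSeg α a.length = a)⟩ => ?_⟩
  · have hn : a.length ≤ n := by simpa [length_initSeg] using h.length_le
    exact ⟨hn, (List.prefix_of_prefix_length_le (initSeg_prefix_initSeg α hn) h
      (length_initSeg _ _).le).eq_of_length (length_initSeg _ _)⟩
  · simpa only [hα] using initSeg_prefix_initSeg α hn

theorem cyl_subset_cyl {a b : List Bool} (h : a <+: b) : cyl b ⊆ cyl a := by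
  rintro α (hα : initSeg α b.length = b)
  exact (prefix_initSeg_iff.1 (hα ▸ h)).2

theorem prefix_of_mem_cyl {α : Cantor} {a b : List Bool} (ha : α ∈ cyl a) (hb : α ∈ cyl b)
    (h : a.length ≤ b.length) : a <+: b := by
  simpa only [show initSeg α b.length = b from hb] using prefix_initSeg_iff.2 ⟨h, ha⟩

theorem prefix_or_prefix_of_mem_cyl {α : Cantor} {a b : List Bool} (ha : α ∈ cyl a)
    (hb : α ∈ cyl b) : a <+: b ∨ b <+: a :=
  (le_total a.length b.length).imp (prefix_of_mem_cyl ha hb) (prefix_of_mem_cyl hb ha)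

theorem cyl_nonempty (a : List Bool) : (cyl a).Nonempty :=
  ⟨fun i => a.getD i false, List.ext_getElem (length_initSeg _ _) fun i _ hi => by
    simp [initSeg, hi]⟩

theorem cyl_initSeg (α : Cantor) (n : ℕ) : cyl (initSeg α n) = PiNat.cylinder α n := by
  ext β
  rw [cyl, Set.mem_ofPred_eq, length_initSeg, PiNat.mem_cylinder_iff]
  simp [initSeg]

theorem exists_cyl_eq_cylinder (a : List Bool) : ∃ α : Cantor, cyl a = PiNat.cylinder α a.length :=
  let ⟨α, hα⟩ := cyl_nonempty a
  ⟨α, by rw [← cyl_initSeg, show initSeg α a.length = a from hα]⟩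

theorem isClopen_cyl (a : List Bool) : IsClopen (cyl a) := by
  obtain ⟨α, hα⟩ := exists_cyl_eq_cylinder a
  rw [hα]
  refine ⟨?_, PiNat.isOpen_cylinder _ α _⟩
  rw [PiNat.cylinder_eq_pi]
  exact isClosed_set_pi fun _ _ => isClosed_singleton

theorem measurableSet_cyl (a : List Bool) : MeasurableSet (cyl a) :=
  (isClopen_cyl a).isOpen.measurableSet

theorem isTopologicalBasis_range_cyl :
    TopologicalSpace.IsTopologicalBasis (Set.range cyl) := by
  convert PiNat.isTopologicalBasis_cylinders fun _ : ℕ => Bool using 1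
  ext s
  constructor
  · rintro ⟨a, rfl⟩
    obtain ⟨α, hα⟩ := exists_cyl_eq_cylinder a
    exact ⟨α, _, hα⟩
  · rintro ⟨α, n, rfl⟩
    exact ⟨_, cyl_initSeg α n⟩

theorem isPiSystem_range_cyl : IsPiSystem (Set.range cyl) := by
  rintro _ ⟨a, rfl⟩ _ ⟨b, rfl⟩ ⟨α, ha, hb⟩
  rcases prefix_or_prefix_of_mem_cyl ha hb with h | h
  · exact ⟨b, (Set.inter_eq_right.2 (cyl_subset_cyl h)).symm⟩
  · exact ⟨a, (Set.inter_eq_left.2 (cyl_subset_cyl h)).symm⟩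

theorem measure_ext_cyl {μ ν : Measure Cantor} [IsFiniteMeasure μ]
    (h : ∀ a, μ (cyl a) = ν (cyl a)) : μ = ν := by
  refine ext_of_generate_finite (Set.range cyl) ?_ isPiSystem_range_cyl
    (Set.forall_mem_range.2 h) (by simpa only [cyl_nil] using h [])
  exact BorelSpace.measurable_eq.trans isTopologicalBasis_range_cyl.borel_eq_generateFrom

theorem pairwiseDisjoint_cyl_of_isAntichain {A : Set (List Bool)}
    (hA : IsAntichain (· <+: ·) A) : A.PairwiseDisjoint cyl :=
  fun _a ha _b hb hab => Set.disjoint_left.2 fun _α h₁ h₂ =>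
    (prefix_or_prefix_of_mem_cyl h₁ h₂).elim (hA ha hb hab) (hA hb ha hab.symm)

theorem exists_isAntichain_biUnion_cyl_eq (A : Set (List Bool)) :
    ∃ M ⊆ A, IsAntichain (· <+: ·) M ∧ ⋃ a ∈ M, cyl a = ⋃ a ∈ A, cyl a := by
  let M : Set (List Bool) := {a ∈ A | ∀ b ∈ A, b <+: a → b = a}
  have hMA : M ⊆ A := Set.sep_subset _ _
  refine ⟨M, hMA, fun a ha b hb hab h => hab (hb.2 a ha.1 h), ?_⟩
  refine (Set.biUnion_subset_biUnion_left hMA).antisymm (Set.iUnion₂_subset fun a ha => ?_)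
  obtain ⟨m, ⟨hmA, hma⟩, hmin⟩ := exists_minimalFor_of_wellFoundedLT
    (fun b => b ∈ A ∧ b <+: a) List.length ⟨a, ha, List.prefix_rfl⟩
  have hmM : m ∈ M := ⟨hmA, fun b hbA hbm => hbm.eq_of_length
    (hbm.length_le.antisymm (hmin ⟨hbA, hbm.trans hma⟩ hbm.length_le))⟩
  exact (cyl_subset_cyl hma).trans (Set.subset_biUnion_of_mem (u := cyl) hmM)

theorem measure_biUnion_cyl_le_of_forall_le {μ ν : Measure Cantor} {A : Set (List Bool)}
    (h : ∀ a ∈ A, μ (cyl a) ≤ ν (cyl a)) : μ (⋃ a ∈ A, cyl a) ≤ ν (⋃ a ∈ A, cyl a) := by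
  obtain ⟨M, hMA, hM, hMA_eq⟩ := exists_isAntichain_biUnion_cyl_eq A
  have hsum (ρ : Measure Cantor) : ρ (⋃ a ∈ A, cyl a) = ∑' a : M, ρ (cyl a) := by
    rw [← hMA_eq, measure_biUnion (Set.to_countable M) (pairwiseDisjoint_cyl_of_isAntichain hM)
      fun a _ => measurableSet_cyl a]
  rw [hsum, hsum]
  exact ENNReal.tsum_le_tsum fun a => h a (hMA a.2)

theorem measure_biUnion_cyl_le_of_forall_finset {μ : Measure Cantor} {A : Set (List Bool)}
    {C : ℝ≥0∞} (h : ∀ D : Finset (List Bool), ↑D ⊆ A → IsAntichain (· <+: ·) (D : Set (List Bool)) →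
      ∑ v ∈ D, μ (cyl v) ≤ C) : μ (⋃ v ∈ A, cyl v) ≤ C := by
  obtain ⟨M, hMA, hM, hMA_eq⟩ := exists_isAntichain_biUnion_cyl_eq A
  rw [← hMA_eq, measure_biUnion (Set.to_countable M) (pairwiseDisjoint_cyl_of_isAntichain hM)
    fun v _ => measurableSet_cyl v, ENNReal.tsum_eq_iSup_sum]
  refine iSup_le fun s => ?_
  have hs : ((s.map (.subtype _) : Finset (List Bool)) : Set (List Bool)) ⊆ M := by simp
  simpa using h _ (hs.trans hMA) (hM.subset hs)

end CantorSpace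

section Rectangles

variable (P : Measure (Cantor × Cantor))

theorem measurableSet_rect (p : List Bool × List Bool) : MeasurableSet (rect p) :=
  (measurableSet_cyl _).prod (measurableSet_cyl _)

theorem fst_cyl (a : List Bool) : P.fst (cyl a) = P (rect (a, [])) := by
  rw [Measure.fst_apply (measurableSet_cyl a), rect, cyl_nil, Set.prod_univ]

theorem fst_restrict_cyl (S : Set (Cantor × Cantor)) (a : List Bool) :
    (P.restrict S).fst (cyl a) = P (rect (a, []) ∩ S) := by
  rw [fst_cyl, Measure.restrict_apply (measurableSet_rect _)]

theorem fst_restrict_univ_prod_cyl (a b : List Bool) :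
    (P.restrict (Set.univ ×ˢ cyl b)).fst (cyl a) = P (rect (a, b)) := by
  rw [fst_restrict_cyl, rect, cyl_nil, Set.prod_inter_prod, Set.inter_univ, Set.univ_inter, rect]

theorem snd_cond_cyl_prod_univ (a b : List Bool) :
    (P[|cyl a ×ˢ Set.univ]).snd (cyl b) = P (rect (a, b)) / P.fst (cyl a) := by
  rw [Measure.snd_apply (measurableSet_cyl b),
    ProbabilityTheory.cond_apply ((measurableSet_cyl a).prod .univ), ← Set.univ_prod,
    Set.prod_inter_prod, Set.inter_univ, Set.univ_inter, fst_cyl, rect, rect, cyl_nil,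
    mul_comm, div_eq_mul_inv]

end Rectangles

section MartinLof

variable {ι X : Type*} [Primcodable ι] [MeasurableSpace X] {B : ι → Set X} {μ : Measure X}

theorem IsMLRandom.frequently_notMem {x : X} (hx : IsMLRandom B μ x) {W : ℕ × ι → Prop}
    (hW : REPred W) {C r : ℝ≥0∞} (hC : C ≠ ∞) (hr : r < 1)
    (hμW : ∀ n, μ (⋃ i ∈ {i | W (n, i)}, B i) ≤ C * r ^ n) :
    ∃ᶠ n in atTop, x ∉ ⋃ i ∈ {i | W (n, i)}, B i := by
  refine frequently_atTop.2 fun n₀ => ?_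
  obtain ⟨K, hK⟩ : ∃ K : ℕ, r ^ K ≤ 2⁻¹ :=
    ((ENNReal.tendsto_pow_atTop_nhds_zero_of_lt_one hr).eventually_le_const (by simp)).exists
  obtain ⟨M, hM⟩ : ∃ M : ℕ, C * r ^ M ≤ 1 := by
    have hlim : Tendsto (fun M : ℕ => C * r ^ M) atTop (𝓝 0) := by
      simpa using ENNReal.Tendsto.const_mul
        (ENNReal.tendsto_pow_atTop_nhds_zero_of_lt_one hr) (Or.inr hC)
    exact (hlim.eventually_le_const one_pos).exists
  -- Along these levels the bound `C * r ^ m` drops below `2 ^ (-n)`, and all of them are `≥ n₀`.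
  let k (n : ℕ) : ℕ := M + n₀ + K * n
  have hk : Primrec k :=
    Primrec.nat_add.comp (Primrec.const _) (Primrec.nat_mul.comp (Primrec.const K) Primrec.id)
  have htest : IsMLTest B μ fun n => ⋃ i ∈ {i | W (k n, i)}, B i := by
    refine ⟨⟨_, rePred_comp hW ((hk.comp Primrec.fst).pair Primrec.snd).to_comp, fun n => rfl⟩,
      fun n => (hμW _).trans ?_⟩
    calc C * r ^ k n = C * r ^ M * r ^ n₀ * (r ^ K) ^ n := by ring
      _ ≤ 1 * 1 * 2⁻¹ ^ n := by gcongr; exact pow_le_one₀ zero_le hr.le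
      _ = (2 ^ n)⁻¹ := by rw [one_mul, one_mul, ENNReal.inv_pow]
  obtain ⟨n, hn⟩ : ∃ n, x ∉ ⋃ i ∈ {i | W (k n, i)}, B i := by
    simpa only [Set.mem_iInter, not_forall] using hx _ htest
  exact ⟨k n, by lia, hn⟩

theorem IsMLRandom.measure_ne_zero {x : X} (hx : IsMLRandom B μ x) {i : ι} (hi : x ∈ B i) :
    μ (B i) ≠ 0 := by
  intro h₀
  have hW : REPred fun y : ℕ × ι => y.2 = i :=
    rePred_of_primrecPred (Primrec.eq.comp Primrec.snd (Primrec.const i))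
  have htest : IsMLTest B μ fun _ => B i := ⟨⟨_, hW, fun n => by simp⟩, fun n => by simp [h₀]⟩
  exact hx _ htest (Set.mem_iInter.2 fun _ => hi)

theorem countable_setOf_isMLTest : {U | IsMLTest B μ U}.Countable := by
  refine ((countable_setOf_rePred (α := ℕ × ι)).image
    fun W n => ⋃ i ∈ {i | W (n, i)}, B i).mono ?_
  rintro U ⟨⟨W, hW, hUW⟩, -⟩
  exact ⟨W, hW, (funext hUW).symm⟩

theorem setOf_isMLRandom_eq :
    {x | IsMLRandom B μ x} = ⋂ U ∈ {U | IsMLTest B μ U}, (⋂ n, U n)ᶜ := by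
  ext x
  simp only [IsMLRandom, Set.mem_ofPred_eq, Set.mem_iInter₂, Set.mem_compl_iff]

theorem measurableSet_setOf_isMLRandom (hB : ∀ i, MeasurableSet (B i)) :
    MeasurableSet {x | IsMLRandom B μ x} := by
  have : Countable ι := Encodable.countable
  rw [setOf_isMLRandom_eq]
  refine MeasurableSet.biInter countable_setOf_isMLTest fun U hU => ?_
  obtain ⟨⟨W, -, hUW⟩, -⟩ := hU
  refine (MeasurableSet.iInter fun n => ?_).compl
  rw [hUW]
  exact MeasurableSet.biUnion (Set.to_countable _) fun i _ => hB i

theorem ae_isMLRandom {Y : Type*} [MeasurableSpace Y] {ρ : Measure Y} {f : Y → X}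
    (h : ∀ U, IsMLTest B μ U → ρ (f ⁻¹' ⋂ n, U n) = 0) : ∀ᵐ y ∂ρ, IsMLRandom B μ (f y) := by
  simp only [IsMLRandom]
  refine (ae_ball_iff countable_setOf_isMLTest).2 fun U hU => ?_
  exact measure_eq_zero_iff_ae_notMem.1 (h U hU)

end MartinLof

section Upcrossings

variable {μ ν : Measure Cantor} {q r : ℝ≥0} {α : Cantor}

/-- Between the prefix `c` of `a` and `a` itself, the ratio `ν [u] / μ [u]` is first less than `q`
and then, at `a`, greater than `r`. The longer string comes first, so that a sequence of
upcrossings ending in `a` is a list with head `a` which is a chain for this relation. -/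
def UpcrossingStep (μ ν : Measure Cantor) (q r : ℝ≥0) (a c : List Bool) : Prop :=
  ∃ u, (c <+: u ∧ u <+: a) ∧ ν (cyl u) < q * μ (cyl u) ∧ r * μ (cyl a) < ν (cyl a)

/-- At least `k` upcrossings of `(q, r)` by the ratio `ν [u] / μ [u]` occur along the prefixes `u`
of `a`, the last of them at `a`. -/
def HasUpcrossings (μ ν : Measure Cantor) (q r : ℝ≥0) (k : ℕ) (a : List Bool) : Prop :=
  ∃ l : List (List Bool), l.length = k ∧ (a :: l).IsChain (UpcrossingStep μ ν q r)

theorem hasUpcrossings_zero (a : List Bool) : HasUpcrossings μ ν q r 0 a :=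
  ⟨[], rfl, .singleton a⟩

theorem hasUpcrossings_succ_iff {k : ℕ} {a : List Bool} :
    HasUpcrossings μ ν q r (k + 1) a ↔
      ∃ c, UpcrossingStep μ ν q r a c ∧ HasUpcrossings μ ν q r k c := by
  constructor
  · rintro ⟨l, hl, hchain⟩
    obtain ⟨c, l, rfl⟩ := List.exists_cons_of_length_eq_add_one hl
    rw [List.isChain_cons_cons] at hchain
    exact ⟨c, hchain.1, l, by simpa using hl, hchain.2⟩
  · rintro ⟨c, hac, l, hl, hchain⟩
    exact ⟨c :: l, by simpa using hl, List.isChain_cons_cons.2 ⟨hac, hchain⟩⟩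

/-- The open set of sequences along which the ratio `ν [u] / μ [u]` has at least `k` upcrossings
of `(q, r)`. -/
def upcrossingSet (μ ν : Measure Cantor) (q r : ℝ≥0) (k : ℕ) : Set Cantor :=
  ⋃ a ∈ {a | HasUpcrossings μ ν q r k a}, cyl a

theorem mul_measure_upcrossingSet_succ_le (k : ℕ) :
    r * μ (upcrossingSet μ ν q r (k + 1)) ≤ q * μ (upcrossingSet μ ν q r k) := by
  set V := upcrossingSet μ ν q r
  let A : Set (List Bool) :=
    {u | ν (cyl u) < q * μ (cyl u) ∧ ∃ c, HasUpcrossings μ ν q r k c ∧ c <+: u}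
  have hV_subset : V (k + 1) ⊆ ⋃ u ∈ A, cyl u := by
    refine Set.iUnion₂_subset fun a ha => ?_
    obtain ⟨c, ⟨u, ⟨hcu, hua⟩, hu, -⟩, hc⟩ := hasUpcrossings_succ_iff.1 ha
    have huA : u ∈ A := ⟨hu, c, hc, hcu⟩
    exact (cyl_subset_cyl hua).trans (Set.subset_biUnion_of_mem (u := cyl) huA)
  have hA_subset : ⋃ u ∈ A, cyl u ⊆ V k := by
    refine Set.iUnion₂_subset fun u ⟨_, c, hc, hcu⟩ => ?_
    exact (cyl_subset_cyl hcu).trans (Set.subset_biUnion_of_mem (u := cyl) hc)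
  have hV_le : ((r : ℝ≥0∞) • μ) (V (k + 1)) ≤ ν (V (k + 1)) :=
    measure_biUnion_cyl_le_of_forall_le fun a ha => by
      obtain ⟨c, ⟨u, -, -, h⟩, -⟩ := hasUpcrossings_succ_iff.1 ha
      exact h.le
  have hA_le : ν (⋃ u ∈ A, cyl u) ≤ ((q : ℝ≥0∞) • μ) (⋃ u ∈ A, cyl u) :=
    measure_biUnion_cyl_le_of_forall_le fun u hu => hu.1.le
  calc r * μ (V (k + 1)) ≤ ν (V (k + 1)) := hV_le
    _ ≤ ν (⋃ u ∈ A, cyl u) := measure_mono hV_subset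
    _ ≤ q * μ (⋃ u ∈ A, cyl u) := hA_le
    _ ≤ q * μ (V k) := by gcongr

theorem measure_upcrossingSet_le (hr : r ≠ 0) (k : ℕ) :
    μ (upcrossingSet μ ν q r k) ≤ μ Set.univ * ((q / r : ℝ≥0) : ℝ≥0∞) ^ k := by
  induction k with
  | zero => simpa using measure_mono (Set.subset_univ _)
  | succ k ih =>
    have hr' : (r : ℝ≥0∞) ≠ 0 := ENNReal.coe_ne_zero.2 hr
    calc μ (upcrossingSet μ ν q r (k + 1)) ≤ (q * μ (upcrossingSet μ ν q r k)) / r := by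
          rw [ENNReal.le_div_iff_mul_le (Or.inl hr') (Or.inl ENNReal.coe_ne_top), mul_comm]
          exact mul_measure_upcrossingSet_succ_le k
      _ = μ (upcrossingSet μ ν q r k) * (q / r : ℝ≥0) := by
          rw [ENNReal.coe_div hr, mul_comm, mul_div_assoc]
      _ ≤ _ := by rw [pow_succ, ← mul_assoc]; gcongr

theorem mem_upcrossingSet_of_frequently
    (hq : ∃ᶠ n in atTop, ν (cyl (initSeg α n)) < q * μ (cyl (initSeg α n)))
    (hr : ∃ᶠ n in atTop, r * μ (cyl (initSeg α n)) < ν (cyl (initSeg α n))) (k : ℕ) :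
    α ∈ upcrossingSet μ ν q r k := by
  suffices h : ∃ n, HasUpcrossings μ ν q r k (initSeg α n) by
    obtain ⟨n, hn⟩ := h
    exact Set.mem_biUnion (s := {a | HasUpcrossings μ ν q r k a}) hn (mem_cyl_initSeg α n)
  induction k with
  | zero => exact ⟨0, hasUpcrossings_zero _⟩
  | succ k ih =>
    obtain ⟨n, hn⟩ := ih
    obtain ⟨m, hnm, hm⟩ := frequently_atTop.1 hq n
    obtain ⟨l, hml, hl⟩ := frequently_atTop.1 hr m
    exact ⟨l, hasUpcrossings_succ_iff.2 ⟨_, ⟨_, ⟨initSeg_prefix_initSeg α hnm,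
      initSeg_prefix_initSeg α hml⟩, hm, hl⟩, hn⟩⟩

theorem rePred_hasUpcrossings (hμ : IsUniformlyComputable fun a => μ (cyl a))
    (hν : IsUniformlyComputable fun a => ν (cyl a)) (q r : ℚ≥0) :
    REPred fun x : ℕ × List Bool => HasUpcrossings μ ν q r x.1 x.2 := by
  have hstep : REPred fun e : List Bool × List Bool => UpcrossingStep μ ν q r e.1 e.2 := by
    have hprefix : PrimrecPred fun x : (List Bool × List Bool) × List Bool =>
        x.1.2 <+: x.2 ∧ x.2 <+: x.1.1 :=
      (primrecRel_isPrefix.comp (Primrec.snd.comp Primrec.fst) Primrec.snd).and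
        (primrecRel_isPrefix.comp Primrec.snd (Primrec.fst.comp Primrec.fst))
    have hbelow : REPred fun x : (List Bool × List Bool) × List Bool =>
        ν (cyl x.2) < (q : ℝ≥0) * μ (cyl x.2) :=
      rePred_comp (hν.rePred_lt (hμ.nnratCast_mul q)) Computable.snd
    have habove : REPred fun x : (List Bool × List Bool) × List Bool =>
        (r : ℝ≥0) * μ (cyl x.1.1) < ν (cyl x.1.1) :=
      rePred_comp ((hμ.nnratCast_mul r).rePred_lt hν) (Computable.fst.comp Computable.fst)
    exact rePred_exists (rePred_and (rePred_of_primrecPred hprefix) (rePred_and hbelow habove))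
  have hlength : PrimrecPred fun x : (ℕ × List Bool) × List (List Bool) => x.2.length = x.1.1 :=
    Primrec.eq.comp (Primrec.list_length.comp Primrec.snd) (Primrec.fst.comp Primrec.fst)
  have hcons : Computable fun x : (ℕ × List Bool) × List (List Bool) => x.1.2 :: x.2 :=
    Computable.list_cons.comp (Computable.snd.comp Computable.fst) Computable.snd
  exact rePred_exists (rePred_and (rePred_of_primrecPred hlength)
    (rePred_comp (rePred_isChain hstep) hcons))

theorem dense_range_nnratCast :
    Dense (Set.range fun q : ℚ≥0 => ((q : ℝ≥0) : ℝ≥0∞)) := by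
  refine dense_of_exists_between fun x y hxy => ?_
  obtain ⟨q, hq₀, hxq, hqy⟩ := ENNReal.lt_iff_exists_rat_btwn.1 hxy
  lift q to ℚ≥0 using hq₀
  have hq : Real.toNNReal ((q : ℚ) : ℝ) = (q : ℝ≥0) := Real.toNNReal_coe (r := (q : ℝ≥0))
  rw [hq] at hxq hqy
  exact ⟨_, ⟨q, rfl⟩, hxq, hqy⟩

theorem IsMLRandom.exists_tendsto_measure_cyl_div [IsFiniteMeasure μ] (hα : IsMLRandom cyl μ α)
    (hμ : IsUniformlyComputable fun a => μ (cyl a))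
    (hν : IsUniformlyComputable fun a => ν (cyl a)) :
    ∃ L, Tendsto (fun n => ν (cyl (initSeg α n)) / μ (cyl (initSeg α n))) atTop (𝓝 L) := by
  refine tendsto_of_no_upcrossings dense_range_nnratCast ?_
  rintro _ ⟨q, rfl⟩ _ ⟨r, rfl⟩ hqr ⟨hbelow, habove⟩
  rw [ENNReal.coe_lt_coe] at hqr
  have hbelow' : ∃ᶠ n in atTop, ν (cyl (initSeg α n)) < (q : ℝ≥0) * μ (cyl (initSeg α n)) :=
    hbelow.mono fun n hn => (ENNReal.div_lt_iff (Or.inl (hα.measure_ne_zero (mem_cyl_initSeg α n)))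
      (Or.inl (measure_ne_top _ _))).1 hn
  have habove' : ∃ᶠ n in atTop, (r : ℝ≥0) * μ (cyl (initSeg α n)) < ν (cyl (initSeg α n)) :=
    habove.mono fun n hn => ENNReal.mul_lt_of_lt_div hn
  have hr : (r : ℝ≥0) ≠ 0 := (zero_le.trans_lt hqr).ne'
  have hratio : (((q : ℝ≥0) / r : ℝ≥0) : ℝ≥0∞) < 1 := by
    rw [ENNReal.coe_lt_one_iff]; exact (div_lt_one (zero_le.trans_lt hqr)).2 hqr
  obtain ⟨k, hk⟩ := (hα.frequently_notMem (rePred_hasUpcrossings hμ hν q r) (measure_ne_top μ _)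
    hratio (measure_upcrossingSet_le hr)).exists
  exact hk (mem_upcrossingSet_of_frequently hbelow' habove' k)

end Upcrossings

section ConditionalMeasure

variable {P : Measure (Cantor × Cantor)} [IsFiniteMeasure P] {α : Cantor} {Q Q' : Measure Cantor}

theorem IsComputableMeasure.isUniformlyComputable (hP : IsComputableMeasure P) :
    IsUniformlyComputable fun p => P (rect p) := by
  obtain ⟨f, hf, hPf⟩ := hP
  refine ⟨fun p => measure_ne_top _ _, f, fun _ => 1, hf, Computable.const 1, fun p n => ?_⟩
  have hscale : 2 ^ n * (P (rect p)).toReal - f (p, n) =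
      2 ^ n * (P.real (rect p) - f (p, n) / 2 ^ n) := by
    rw [measureReal_def]; field_simp
  calc |2 ^ n * (P (rect p)).toReal - f (p, n)| = 2 ^ n * |P.real (rect p) - f (p, n) / 2 ^ n| := by
        rw [hscale, abs_mul, abs_of_pos (by positivity)]
    _ ≤ 2 ^ n * (1 / 2 ^ n) := by gcongr; exact hPf p n
    _ = (1 : ℕ) := by field_simp; norm_num

theorem IsMLRandom.exists_tendsto_rect_div (hα : IsMLRandom cyl P.fst α)
    (hP : IsUniformlyComputable fun p => P (rect p)) (b : List Bool) :
    ∃ L, Tendsto (fun n => P (rect (initSeg α n, b)) / P.fst (cyl (initSeg α n))) atTop (𝓝 L) := by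
  have hslice (b : List Bool) : IsUniformlyComputable fun a => P (rect (a, b)) :=
    hP.comp (Computable.id.pair (Computable.const b))
  simp only [← fst_restrict_univ_prod_cyl]
  refine hα.exists_tendsto_measure_cyl_div ?_ ?_
  · simpa only [fst_cyl] using hslice []
  · simpa only [fst_restrict_univ_prod_cyl] using hslice b

theorem exists_measure_tendsto_cyl (ρ : ℕ → ProbabilityMeasure Cantor)
    (hρ : ∀ b, ∃ L, Tendsto (fun n => (ρ n : Measure Cantor) (cyl b)) atTop (𝓝 L)) :
    ∃ Q : Measure Cantor,
      ∀ b, Tendsto (fun n => (ρ n : Measure Cantor) (cyl b)) atTop (𝓝 (Q (cyl b))) := by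
  obtain ⟨Q, -, hQ⟩ := isCompact_univ.ultrafilter_le_nhds ((hyperfilter ℕ).map ρ) (by simp)
  refine ⟨Q, fun b => ?_⟩
  obtain ⟨L, hL⟩ := hρ b
  have hlim : Tendsto (fun n => (ρ n : Measure Cantor) (cyl b)) (hyperfilter ℕ)
      (𝓝 ((Q : Measure Cantor) (cyl b))) :=
    ProbabilityMeasure.tendsto_measure_of_null_frontier_of_tendsto' hQ
      (by rw [(isClopen_cyl b).frontier_eq, measure_empty])
  rwa [← tendsto_nhds_unique hlim (hL.mono_left Nat.hyperfilter_le_atTop)] at hL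

theorem IsMLRandom.exists_isConditionalMeasure (hα : IsMLRandom cyl P.fst α)
    (hP : IsUniformlyComputable fun p => P (rect p)) : ∃ Q, IsConditionalMeasure P α Q := by
  have hpos (n : ℕ) : P.fst (cyl (initSeg α n)) ≠ 0 := hα.measure_ne_zero (mem_cyl_initSeg α n)
  let ρ (n : ℕ) : Measure Cantor := (P[|cyl (initSeg α n) ×ˢ Set.univ]).snd
  have hρ (n : ℕ) : IsProbabilityMeasure (ρ n) := by
    have : IsProbabilityMeasure P[|cyl (initSeg α n) ×ˢ Set.univ] :=
      ProbabilityTheory.cond_isProbabilityMeasure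
        (by simpa only [fst_cyl, rect, cyl_nil] using hpos n)
    infer_instance
  obtain ⟨Q, hQ⟩ := exists_measure_tendsto_cyl (fun n => ⟨ρ n, hρ n⟩) fun b => by
    simpa only [ProbabilityMeasure.coe_mk, ρ, snd_cond_cyl_prod_univ]
      using hα.exists_tendsto_rect_div hP b
  exact ⟨Q, hpos, fun b => by
    simpa only [ProbabilityMeasure.coe_mk, ρ, snd_cond_cyl_prod_univ] using hQ b⟩

theorem IsConditionalMeasure.isProbabilityMeasure (hQ : IsConditionalMeasure P α Q) :
    IsProbabilityMeasure Q := by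
  refine ⟨?_⟩
  have hlim := hQ.2 []
  simp only [← fst_cyl, ENNReal.div_self (hQ.1 _) (measure_ne_top _ _), cyl_nil] at hlim
  exact tendsto_nhds_unique hlim tendsto_const_nhds

theorem IsConditionalMeasure.unique (hQ : IsConditionalMeasure P α Q)
    (hQ' : IsConditionalMeasure P α Q') : Q = Q' :=
  have := hQ.isProbabilityMeasure
  measure_ext_cyl fun b => tendsto_nhds_unique (hQ.2 b) (hQ'.2 b)

end ConditionalMeasure

section Sections

variable {P : Measure (Cantor × Cantor)} {E : Set (List Bool × List Bool)} {c : ℕ} {α : Cantor}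

/-- Above `[a]`, the open set `⋃ w ∈ E, rect w` has conditional measure greater than `1 / c`, and
this is witnessed by finitely many pairwise incompatible strings `v` such that `[a] × [v]` lies
inside one of its rectangles. Such witnesses can be searched for. -/
def IsHeavyPrefix (P : Measure (Cantor × Cantor)) (E : Set (List Bool × List Bool)) (c : ℕ)
    (a : List Bool) : Prop :=
  ∃ D : Finset (List Bool), IsAntichain (· <+: ·) (D : Set (List Bool)) ∧
    (∀ v ∈ D, ∃ u, (u, v) ∈ E ∧ u <+: a) ∧ P (rect (a, [])) < c * ∑ v ∈ D, P (rect (a, v))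

theorem isHeavyPrefix_iff_exists_list {a : List Bool} :
    IsHeavyPrefix P E c a ↔ ∃ l : List (List Bool), (l.Nodup ∧ IsAntichain (· <+: ·) {v | v ∈ l}) ∧
      (∀ v ∈ l, ∃ u, (u, v) ∈ E ∧ u <+: a) ∧
        P (rect (a, [])) < c * (l.map fun v => P (rect (a, v))).sum := by
  constructor
  · rintro ⟨D, hD, hDE, hlt⟩
    refine ⟨D.toList, ⟨D.nodup_toList, ?_⟩, ?_, ?_⟩
    · simpa using hD
    · simpa using hDE
    · simpa using hlt
  · rintro ⟨l, ⟨hl, hl'⟩, hlE, hlt⟩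
    refine ⟨l.toFinset, by simpa using hl', by simpa using hlE, ?_⟩
    rwa [List.sum_toFinset _ hl]

theorem rePred_isHeavyPrefix {γ : Type*} [Primcodable γ] {W : γ × List Bool × List Bool → Prop}
    (hP : IsUniformlyComputable fun p => P (rect p)) (hW : REPred W) :
    REPred fun x : (γ × ℕ) × List Bool => IsHeavyPrefix P {w | W (x.1.1, w)} x.1.2 x.2 := by
  have hantichain : REPred fun x : ((γ × ℕ) × List Bool) × List (List Bool) =>
      x.2.Nodup ∧ IsAntichain (· <+: ·) {v | v ∈ x.2} :=
    rePred_of_primrecPred ((primrecPred_nodup.comp Primrec.snd).and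
      ((primrecPred_isAntichain primrecRel_isPrefix).comp Primrec.snd))
  have hE : REPred fun x : ((γ × ℕ) × List Bool) × List (List Bool) =>
      ∀ v ∈ x.2, ∃ u, W (x.1.1.1, u, v) ∧ u <+: x.1.2 := by
    have hEv : REPred fun y : (List Bool × γ × List Bool) × List Bool =>
        W (y.1.2.1, y.2, y.1.1) ∧ y.2 <+: y.1.2.2 := by
      refine rePred_and (rePred_comp hW ?_) (rePred_of_primrecPred ?_)
      · exact ((Primrec.fst.comp (Primrec.snd.comp Primrec.fst)).pair
          (Primrec.snd.pair (Primrec.fst.comp Primrec.fst))).to_comp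
      · exact primrecRel_isPrefix.comp Primrec.snd
          (Primrec.snd.comp (Primrec.snd.comp Primrec.fst))
    exact rePred_comp (rePred_forall_mem_list (rePred_exists hEv)) (Primrec.snd.pair
      ((Primrec.fst.comp (Primrec.fst.comp Primrec.fst)).pair
        (Primrec.snd.comp Primrec.fst))).to_comp
  have hlt : REPred fun x : ((γ × ℕ) × List Bool) × List (List Bool) =>
      P (rect (x.1.2, [])) < x.1.1.2 * (x.2.map fun v => P (rect (x.1.2, v))).sum := by
    have ha : Primrec fun x : ((γ × ℕ) × List Bool) × List (List Bool) => x.1.2 :=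
      Primrec.snd.comp Primrec.fst
    have hc : Primrec fun x : ((γ × ℕ) × List Bool) × List (List Bool) => x.1.1.2 :=
      Primrec.snd.comp (Primrec.fst.comp Primrec.fst)
    have hswap : IsUniformlyComputable fun y : List Bool × List Bool => P (rect (y.2, y.1)) :=
      hP.comp (Computable.snd.pair Computable.fst)
    have hsum := (hswap.list_sum_map.comp (Primrec.snd.pair ha).to_comp).natCast_mul hc.to_comp
    exact (hP.comp (ha.pair (Primrec.const [])).to_comp).rePred_lt hsum
  refine (rePred_exists (rePred_and hantichain (rePred_and hE hlt))).of_eq fun x => ?_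
  simp only [isHeavyPrefix_iff_exists_list, Set.mem_ofPred_eq]

theorem IsHeavyPrefix.fst_cyl_le {a : List Bool} (h : IsHeavyPrefix P E c a) :
    P.fst (cyl a) ≤ c * (P.restrict (⋃ w ∈ E, rect w)).fst (cyl a) := by
  obtain ⟨D, hD, hDE, hlt⟩ := h
  rw [fst_cyl, fst_restrict_cyl]
  refine hlt.le.trans ?_
  gcongr
  have hdisj : (D : Set (List Bool)).PairwiseDisjoint fun v => rect (a, v) :=
    fun v hv w hw hvw =>
      Set.Disjoint.set_prod_right (pairwiseDisjoint_cyl_of_isAntichain hD hv hw hvw) _ _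
  rw [← measure_biUnion_finset hdisj fun v _ => measurableSet_rect _]
  refine measure_mono (Set.iUnion₂_subset fun v hv => Set.subset_inter ?_ ?_)
  · exact Set.prod_mono_right (cyl_subset_cyl List.nil_prefix)
  · obtain ⟨u, huE, hua⟩ := hDE v hv
    exact (Set.prod_mono_left (cyl_subset_cyl hua)).trans
      (Set.subset_biUnion_of_mem (u := rect) huE)

theorem fst_biUnion_isHeavyPrefix_le :
    P.fst (⋃ a ∈ {a | IsHeavyPrefix P E c a}, cyl a) ≤ c * P (⋃ w ∈ E, rect w) := by
  set U := ⋃ w ∈ E, rect w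
  set V := ⋃ a ∈ {a | IsHeavyPrefix P E c a}, cyl a
  calc P.fst V ≤ ((c : ℝ≥0∞) • (P.restrict U).fst) V :=
        measure_biUnion_cyl_le_of_forall_le fun a ha => IsHeavyPrefix.fst_cyl_le ha
    _ ≤ c * (P.restrict U).fst Set.univ := by
        rw [Measure.smul_apply, smul_eq_mul]; gcongr; exact Set.subset_univ _
    _ = c * P U := by rw [Measure.fst_univ, Measure.restrict_apply_univ]

theorem preimage_biUnion_rect :
    Prod.mk α ⁻¹' ⋃ w ∈ E, rect w = ⋃ v ∈ {v | ∃ u, (u, v) ∈ E ∧ α ∈ cyl u}, cyl v := by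
  ext β
  simp only [rect, Set.mem_preimage, Set.mem_iUnion, Prod.exists, Set.mem_prod, Set.mem_ofPred_eq,
    exists_prop]
  tauto

theorem IsConditionalMeasure.measure_section_le [IsFiniteMeasure P] {Q : Measure Cantor}
    (hQ : IsConditionalMeasure P α Q) (h : ∀ n, ¬ IsHeavyPrefix P E c (initSeg α n)) :
    Q (Prod.mk α ⁻¹' ⋃ w ∈ E, rect w) ≤ (c : ℝ≥0∞)⁻¹ := by
  rw [preimage_biUnion_rect]
  refine measure_biUnion_cyl_le_of_forall_finset fun D hDE hD => ?_
  have hD_prefix : ∀ᶠ n in atTop, ∀ v ∈ D, ∃ u, (u, v) ∈ E ∧ u <+: initSeg α n := by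
    refine (Finset.eventually_all D).2 fun v hv => ?_
    obtain ⟨u, huE, hu⟩ := hDE hv
    filter_upwards [eventually_ge_atTop u.length] with n hn
    exact ⟨u, huE, prefix_initSeg_iff.2 ⟨hn, hu⟩⟩
  refine le_of_tendsto (tendsto_finsetSum D fun v _ => hQ.2 v) ?_
  filter_upwards [hD_prefix] with n hn
  have hlight : c * ∑ v ∈ D, P (rect (initSeg α n, v)) ≤ P.fst (cyl (initSeg α n)) := by
    rw [fst_cyl]
    exact not_lt.1 fun hlt => h n ⟨D, hD, hn, hlt⟩
  have hfst : P.fst (cyl (initSeg α n)) ≠ 0 := hQ.1 n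
  simp only [div_eq_mul_inv, ← Finset.sum_mul]
  rw [← div_eq_mul_inv]
  refine ENNReal.div_le_of_le_mul ?_
  rw [mul_comm, ← div_eq_mul_inv,
    ENNReal.le_div_iff_mul_le (Or.inr hfst) (Or.inr (measure_ne_top _ _)), mul_comm]
  exact hlight

theorem IsMLRandom.frequently_not_isHeavyPrefix [IsFiniteMeasure P]
    (hP : IsUniformlyComputable fun p => P (rect p)) (hα : IsMLRandom cyl P.fst α)
    {W : ℕ × List Bool × List Bool → Prop} (hW : REPred W)
    (hPW : ∀ n, P (⋃ w ∈ {w | W (n, w)}, rect w) ≤ (2 ^ n)⁻¹) :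
    ∃ᶠ n in atTop, ∀ m, ¬ IsHeavyPrefix P {w | W (2 * n, w)} (2 ^ n) (initSeg α m) := by
  have hheavy : REPred fun x : ℕ × List Bool =>
      IsHeavyPrefix P {w | W (2 * x.1, w)} (2 ^ x.1) x.2 := by
    have hpow : Primrec fun n : ℕ => 2 ^ n :=
      (Primrec₂.unpaired'.1 Nat.Primrec.pow).comp (Primrec.const 2) Primrec.id
    exact rePred_comp (p := fun x : (ℕ × ℕ) × List Bool =>
      IsHeavyPrefix P {w | W (x.1.1, w)} x.1.2 x.2) (rePred_isHeavyPrefix hP hW)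
      (((Primrec.nat_double.comp Primrec.fst).pair
      (hpow.comp Primrec.fst)).pair Primrec.snd).to_comp
  have hmeasure (n : ℕ) :
      P.fst (⋃ a ∈ {a | IsHeavyPrefix P {w | W (2 * n, w)} (2 ^ n) a}, cyl a) ≤ 1 * 2⁻¹ ^ n := by
    refine fst_biUnion_isHeavyPrefix_le.trans ?_
    calc ((2 ^ n : ℕ) : ℝ≥0∞) * P (⋃ w ∈ {w | W (2 * n, w)}, rect w)
        ≤ 2 ^ n * (2 ^ (2 * n))⁻¹ := by push_cast; gcongr; exact hPW _
      _ = 1 * 2⁻¹ ^ n := by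
          rw [two_mul, pow_add, ENNReal.mul_inv (by simp) (by simp), ← mul_assoc,
            ENNReal.mul_inv_cancel (by simp) (by simp), ENNReal.inv_pow]
  refine (hα.frequently_notMem hheavy ENNReal.one_ne_top (by simp) hmeasure).mono ?_
  intro n hn m hm
  exact hn (Set.mem_biUnion (s := {a | IsHeavyPrefix P _ _ a}) hm (mem_cyl_initSeg α m))

theorem IsConditionalMeasure.measure_section_iInter_eq_zero [IsFiniteMeasure P]
    {Q : Measure Cantor} (hQ : IsConditionalMeasure P α Q)
    (hP : IsUniformlyComputable fun p => P (rect p)) (hα : IsMLRandom cyl P.fst α)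
    {U : ℕ → Set (Cantor × Cantor)} (hU : IsMLTest rect P U) :
    Q (Prod.mk α ⁻¹' ⋂ n, U n) = 0 := by
  obtain ⟨⟨W, hW, hUW⟩, hPU⟩ := hU
  have hbound : ∃ᶠ n in atTop, Q (Prod.mk α ⁻¹' ⋂ n, U n) ≤ 2⁻¹ ^ n := by
    refine (hα.frequently_not_isHeavyPrefix hP hW fun n => hUW n ▸ hPU n).mono fun n hn => ?_
    calc Q (Prod.mk α ⁻¹' ⋂ n, U n) ≤ Q (Prod.mk α ⁻¹' U (2 * n)) :=
          measure_mono (Set.preimage_mono (Set.iInter_subset _ _))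
      _ ≤ ((2 ^ n : ℕ) : ℝ≥0∞)⁻¹ := by rw [hUW]; exact hQ.measure_section_le hn
      _ = 2⁻¹ ^ n := by rw [Nat.cast_pow, Nat.cast_ofNat, ENNReal.inv_pow]
  have hlim : Tendsto (fun n : ℕ => (2⁻¹ : ℝ≥0∞) ^ n) atTop (𝓝 0) :=
    ENNReal.tendsto_pow_atTop_nhds_zero_of_lt_one (by simp)
  exact le_antisymm (ge_of_tendsto_of_frequently hlim hbound) zero_le

end Sections

theorem mainTheorem2_general (P : Measure (Cantor × Cantor)) [IsFiniteMeasure P]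
    (hP : IsComputableMeasure P) (α₁ : Cantor) (hα₁ : IsMLRandom cyl P.fst α₁) :
    (∃! Q : Measure Cantor, IsConditionalMeasure P α₁ Q) ∧
      ∀ Q : Measure Cantor, IsConditionalMeasure P α₁ Q →
        IsProbabilityMeasure Q ∧
          MeasurableSet {α₂ : Cantor | IsMLRandom rect P (α₁, α₂)} ∧
          Q {α₂ : Cantor | IsMLRandom rect P (α₁, α₂)} = 1 := by
  have hP' := hP.isUniformlyComputable
  obtain ⟨Q, hQ⟩ := hα₁.exists_isConditionalMeasure hP'
  refine ⟨⟨Q, hQ, fun Q' hQ' => hQ'.unique hQ⟩, fun Q hQ => ?_⟩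
  have hQ_prob := hQ.isProbabilityMeasure
  have hmeas : MeasurableSet {α₂ : Cantor | IsMLRandom rect P (α₁, α₂)} :=
    measurable_prodMk_left (measurableSet_setOf_isMLRandom measurableSet_rect)
  have hae : ∀ᵐ α₂ ∂Q, IsMLRandom rect P (α₁, α₂) :=
    ae_isMLRandom fun U hU => hQ.measure_section_iInter_eq_zero hP' hα₁ hU
  exact ⟨hQ_prob, hmeas, (mem_ae_iff_prob_eq_one hmeas).1 hae⟩

theorem mainTheorem2 (P : Measure (Cantor × Cantor)) [IsProbabilityMeasure P]
    (hP : IsComputableMeasure P) (α₁ : Cantor) (hα₁ : IsMLRandom cyl P.fst α₁) :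
    (∃! Q : Measure Cantor, IsConditionalMeasure P α₁ Q) ∧
      ∀ Q : Measure Cantor, IsConditionalMeasure P α₁ Q →
        IsProbabilityMeasure Q ∧
          MeasurableSet {α₂ : Cantor | IsMLRandom rect P (α₁, α₂)} ∧
          Q {α₂ : Cantor | IsMLRandom rect P (α₁, α₂)} = 1 :=
  mainTheorem2_general P hP α₁ hα₁
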